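/- Let $\mathcal X$ be a complete separable metric space with its Borel $\sigma$-field, and let $\mathcal F$ be a countable family of Borel measurable functions $f:\mathcal X\to\mathbb R$ with envelope $F$, i.e. $F:\mathcal X\to[0,\infty)$ is measurable and $|f(x)|\le F(x)$ for all $x\in\mathcal X$ and $f\in\mathcal F$. For a family $\mathcal C$ of subsets of $\mathcal X$, let $\dim(\mathcal C)\in\{0,1,2,\dots,\infty\}$ be its VC dimension, i.e. the supremum of the cardinalities $|D|$ of the finite sets $D\subseteq\mathcal X$ with $|\{C\cap D: C\in\mathcal C\}|=2^{|D|}$ (and $0$ if there are none). Suppose that $\mathcal F$ is a VC-major class, i.e. $$\sup_{\alpha\in\mathbb R}\dim\bigl(\bigl\{\{x\in\mathcal X: f(x)\le\alpha\}: f\in\mathcal F\bigr\}\bigr)<\infty .$$ Then for every stationary ergodic process $X_1,X_2,\dots$ with values in $\mathcal X$ such that $E F(X_1)<\infty$, the expectations $E f(X_1)$, $f\in\mathcal F$, are well defined and finite, and $$\sup_{f\in\mathcal F}\Bigl|\frac1m\sum_{i=1}^m f(X_i)-E f(X_1)\Bigr|\to 0\quad\text{with probability one as } m\to\infty .$$ Here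 a process is ergodic if its invariant $\sigma$-field is trivial, i.e. every shift-invariant measurable set of sequences has probability $0$ or $1$ under the law of the process. -/

import Mathlib

open MeasureTheory Filter
open scoped ENNReal Topology

/-- The shatter coefficient `S(D : 𝒞) = |{C ∩ D : C ∈ 𝒞}|`: the number of distinct subsets of the
finite set `D` that are captured by members of `𝒞`. -/
noncomputable def shatterCoeff {α : Type*} (D : Finset α) (𝒞 : Set (Set α)) : ℕ :=
  Set.ncard {E : Set α | ∃ C ∈ 𝒞, E = C ∩ (D : Set α)}

/-- The VC dimension of a family of sets, with values in `ℕ∞`: the supremum of the cardinalities of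
the finite sets `D` that are shattered by `𝒞`, i.e. such that `S(D : 𝒞) = 2 ^ |D|`
(it is `0` if no nonempty set is shattered). -/
noncomputable def vcDim {α : Type*} (𝒞 : Set (Set α)) : ℕ∞ :=
  ⨆ (D : Finset α) (_ : shatterCoeff D 𝒞 = 2 ^ D.card), (D.card : ℕ∞)

/-- The level set `L_f(a) = {x : f x ≤ a}`. -/
def levelSet {α : Type*} (f : α → ℝ) (a : ℝ) : Set α := {x | f x ≤ a}

/-- `sup_a dim {L_f(a) : f ∈ 𝓕}`, the supremum being over all real levels `a`. -/
noncomputable def vcMajorDim {α : Type*} (𝓕 : Set (α → ℝ)) : ℕ∞ :=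
  ⨆ a : ℝ, vcDim {L : Set α | ∃ f ∈ 𝓕, L = levelSet f a}

/-- A family of real functions is a VC-major class if `sup_a dim {L_f(a) : f ∈ 𝓕}` is finite. -/
def IsVCMajor {α : Type*} (𝓕 : Set (α → ℝ)) : Prop := vcMajorDim 𝓕 < ⊤

/-- `F` is an envelope of `𝓕`: a measurable function to `[0, ∞)` with `|f x| ≤ F x` for all
`f ∈ 𝓕` and all `x`. -/
structure IsEnvelope {α : Type*} [MeasurableSpace α] (F : α → ℝ) (𝓕 : Set (α → ℝ)) : Prop where
  measurable : Measurable F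
  nonneg : ∀ x, 0 ≤ F x
  abs_le : ∀ f ∈ 𝓕, ∀ x, |f x| ≤ F x

/-- The left shift on one-sided sequences. -/
def seqShift {α : Type*} (x : ℕ → α) : ℕ → α := fun n => x (n + 1)

/-- The law of the process `X` on the sequence space (with the product sigma-field). -/
noncomputable def processLaw {Ω α : Type*} [MeasurableSpace Ω] [MeasurableSpace α]
    (X : ℕ → Ω → α) (P : Measure Ω) : Measure (ℕ → α) :=
  P.map (fun ω n => X n ω)

/-- A stationary ergodic process: a sequence of random variables whose law on the sequence space is
preserved by the shift (stationarity) and gives every shift-invariant measurable set measure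
zero or full measure (triviality of the invariant sigma-field). -/
structure IsStationaryErgodic {Ω α : Type*} [MeasurableSpace Ω] [MeasurableSpace α]
    (X : ℕ → Ω → α) (P : Measure Ω) : Prop where
  measurable : ∀ n, Measurable (X n)
  stationary : MeasurePreserving seqShift (processLaw X P) (processLaw X P)
  ergodic : PreErgodic seqShift (processLaw X P)

/-- The random variable `sup_{f ∈ 𝓕} |m⁻¹ ∑ f(X_i) - E f(X)|`, with values in `[0, ∞]`. The first
`m` variables of the process are `X 0, …, X (m - 1)`, and `X` has the law of `X 0`. -/
noncomputable def uniformDeviation {Ω α : Type*} [MeasurableSpace Ω]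
    (𝓕 : Set (α → ℝ)) (X : ℕ → Ω → α) (P : Measure Ω) (m : ℕ) (ω : Ω) : ℝ≥0∞ :=
  ⨆ f ∈ 𝓕, ENNReal.ofReal |(m : ℝ)⁻¹ * (∑ i ∈ Finset.range m, f (X i ω)) - ∫ ω', f (X 0 ω') ∂P|

/-- `𝓕` is a Glivenko–Cantelli class for the process `X`: the expectations `E f(X)` exist, and the
averages converge to them uniformly over `𝓕` with probability one. -/
def IsGlivenkoCantelli {Ω α : Type*} [MeasurableSpace Ω]
    (𝓕 : Set (α → ℝ)) (X : ℕ → Ω → α) (P : Measure Ω) : Prop :=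
  (∀ f ∈ 𝓕, Integrable (fun ω => f (X 0 ω)) P) ∧
    ∀ᵐ ω ∂P, Tendsto (fun m : ℕ => uniformDeviation 𝓕 X P m ω) atTop (𝓝 0)

/-! Two facts combine: Birkhoff's theorem gives the law of large numbers for one function, and
finite VC dimension forces finite bracketing numbers under every finite measure, whatever the
dependence of the process.

The bracketing theorem `exists_finite_brackets` is proved by contradiction. If no finite collection
of brackets of mass below `ε` suffices, some ultrafilter on the index set avoids every such bracket.
Exhausting the regions that lie almost inside, or almost outside, most of the sets must then leave a
nonnull set `G`, for otherwise these regions would form a small bracket. Every nonnull part of `G`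
is split by most of the sets, so members can be picked one after another with all Boolean
combinations nonnull. With `2 ^ k` of them, indexed by the subsets of a `k`-point set, duality
yields `k` shattered points for every `k`.

Sandwiching between finitely many brackets gives the uniform law for the level sets at one level. A
function truncated at height `M` is within `1 / N` of a combination of `2 * M * N` level-set
indicators, and the truncation error is controlled by the tail of the envelope, uniformly over the
family. -/

/-! ### The pointwise ergodic theorem -/

section Birkhoff

variable {α : Type*}

/-- The running maximum `max (0, S₁, …, Sₙ)` of the Birkhoff sums of `f` along `T`. -/
noncomputable def birkhoffMax (T : α → α) (f : α → ℝ) : ℕ → α → ℝ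
  | 0, _ => 0
  | n + 1, x => max 0 (f x + birkhoffMax T f n (T x))

variable {T : α → α} {f : α → ℝ}

lemma birkhoffMax_nonneg (n : ℕ) (x : α) : 0 ≤ birkhoffMax T f n x := by
  cases n with
  | zero => exact le_rfl
  | succ n => exact le_max_left _ _

lemma birkhoffMax_le_succ (n : ℕ) (x : α) :
    birkhoffMax T f n x ≤ birkhoffMax T f (n + 1) x := by
  induction n generalizing x with
  | zero => exact birkhoffMax_nonneg _ _
  | succ n ih => exact max_le_max le_rfl (by linarith [ih (T x)])

lemma birkhoffMax_monotone (x : α) : Monotone fun n => birkhoffMax T f n x :=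
  monotone_nat_of_le_succ fun n => birkhoffMax_le_succ n x

lemma birkhoffSum_le_birkhoffMax (n : ℕ) (x : α) :
    birkhoffSum T f n x ≤ birkhoffMax T f n x := by
  induction n generalizing x with
  | zero => simp [birkhoffMax]
  | succ n ih =>
    rw [birkhoffSum_succ']
    exact le_max_of_le_right (by linarith [ih (T x)])

lemma birkhoffMax_succ_sub (n : ℕ) (x : α) :
    birkhoffMax T f (n + 1) x - birkhoffMax T f n (T x) =
      max (-birkhoffMax T f n (T x)) (f x) := by
  rw [birkhoffMax, ← max_sub_sub_right]
  congr 1 <;> ring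

/-- The set of points along whose orbit the Birkhoff sums are unbounded above. -/
def birkhoffUnbounded (T : α → α) (f : α → ℝ) : Set α :=
  {x | ∀ k : ℕ, ∃ n, (k : ℝ) ≤ birkhoffMax T f n x}

lemma preimage_birkhoffUnbounded : T ⁻¹' birkhoffUnbounded T f = birkhoffUnbounded T f := by
  ext x
  simp only [birkhoffUnbounded, Set.mem_preimage, Set.mem_ofPred_eq]
  -- One step along the orbit changes the maximum by at most about `|f x|`; raising the threshold by
  -- `c` absorbs this.
  obtain ⟨c, hc⟩ := exists_nat_ge |f x|
  constructor <;> intro h k <;> obtain ⟨n, hn⟩ := h (k + c) <;> push_cast at hn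
  · refine ⟨n + 1, le_max_of_le_right ?_⟩
    linarith [neg_abs_le (f x)]
  · refine ⟨n, ?_⟩
    have h1 := birkhoffMax_le_succ (T := T) (f := f) n x
    have h2 : birkhoffMax T f (n + 1) x ≤ |f x| + birkhoffMax T f n (T x) :=
      max_le (add_nonneg (abs_nonneg _) (birkhoffMax_nonneg _ _))
        (add_le_add (le_abs_self _) le_rfl)
    linarith

lemma tendsto_birkhoffMax_of_mem {x : α} (hx : x ∈ birkhoffUnbounded T f) :
    Tendsto (fun n => birkhoffMax T f n x) atTop atTop :=
  tendsto_atTop_atTop_of_monotone (birkhoffMax_monotone x) fun b => by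
    obtain ⟨k, hk⟩ := exists_nat_ge b
    obtain ⟨n, hn⟩ := hx k
    exact ⟨n, hk.trans hn⟩

variable [MeasurableSpace α] {μ : Measure α}

lemma measurable_birkhoffMax (hT : Measurable T) (hf : Measurable f) (n : ℕ) :
    Measurable (birkhoffMax T f n) := by
  induction n with
  | zero => exact measurable_const
  | succ n ih => exact measurable_const.max (hf.add (ih.comp hT))

lemma measurableSet_birkhoffUnbounded (hT : Measurable T) (hf : Measurable f) :
    MeasurableSet (birkhoffUnbounded T f) := by
  simp only [birkhoffUnbounded, Set.ofPred_forall, Set.ofPred_exists]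
  exact .iInter fun k => .iUnion fun n =>
    measurableSet_le measurable_const (measurable_birkhoffMax hT hf n)

lemma integrable_birkhoffMax (hT : MeasurePreserving T μ μ) (hf : Integrable f μ) (n : ℕ) :
    Integrable (birkhoffMax T f n) μ := by
  induction n with
  | zero => exact integrable_zero _ _ _
  | succ n ih =>
    exact (integrable_zero _ _ _).sup (hf.add (hT.integrable_comp_of_integrable ih))

/-- The maximal ergodic inequality. -/
theorem setIntegral_birkhoffUnbounded_nonneg (hT : MeasurePreserving T μ μ) (hf : Measurable f)
    (hfi : Integrable f μ) : 0 ≤ ∫ x in birkhoffUnbounded T f, f x ∂μ := by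
  set A := birkhoffUnbounded T f with hA
  have hAm : MeasurableSet A := measurableSet_birkhoffUnbounded hT.measurable hf
  have hTA : MeasurePreserving T (μ.restrict A) (μ.restrict A) := by
    have := hT.restrict_preimage hAm
    rwa [preimage_birkhoffUnbounded] at this
  have hint n : Integrable (birkhoffMax T f n) (μ.restrict A) :=
    (integrable_birkhoffMax hT hfi n).restrict
  have hlim : Tendsto (fun n => ∫ x in A, max (-birkhoffMax T f n (T x)) (f x) ∂μ) atTop
      (𝓝 (∫ x in A, f x ∂μ)) := by
    refine tendsto_integral_of_dominated_convergence (fun x => |f x|) (fun n => ?_)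
      hfi.abs.restrict (fun n => ae_of_all _ fun x => ?_) ?_
    · exact (((measurable_birkhoffMax hT.measurable hf n).comp hT.measurable).neg.max
        hf).aestronglyMeasurable
    · rw [Real.norm_eq_abs, abs_le]
      exact ⟨le_max_of_le_right (neg_abs_le _), max_le
        ((neg_nonpos.2 (birkhoffMax_nonneg _ _)).trans (abs_nonneg _)) (le_abs_self _)⟩
    · filter_upwards [ae_restrict_mem hAm] with x hx
      -- By invariance `T x` is also in `A`, so the maxima at `T x` tend to infinity and the
      -- integrand is eventually `f x`.
      rw [hA, ← preimage_birkhoffUnbounded] at hx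
      refine tendsto_const_nhds.congr' ?_
      filter_upwards [(tendsto_birkhoffMax_of_mem hx).eventually_ge_atTop (-f x)] with n hn
      exact (max_eq_right (by linarith)).symm
  -- As `T` preserves the restricted measure, composition with `T` drops out of the integral,
  -- leaving the increment of a sequence increasing in `n`.
  refine ge_of_tendsto' hlim fun n => ?_
  have hcomp : ∫ x in A, birkhoffMax T f n (T x) ∂μ = ∫ x in A, birkhoffMax T f n x ∂μ := by
    conv_rhs => rw [← hTA.map_eq]
    rw [integral_map hT.measurable.aemeasurable
      (measurable_birkhoffMax hT.measurable hf n).aestronglyMeasurable]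
  have hcompi : Integrable (fun x => birkhoffMax T f n (T x)) (μ.restrict A) :=
    hTA.integrable_comp_of_integrable (hint n)
  simp_rw [← birkhoffMax_succ_sub]
  rw [integral_sub (hint _) hcompi, hcomp, sub_nonneg]
  exact integral_mono (hint _) (hint _) fun x => birkhoffMax_le_succ n x

/-- By ergodicity the invariant unbounded set is null or conull; the maximal inequality would make
the whole integral nonnegative in the conull case. -/
lemma ae_birkhoffSum_bddAbove (hT : MeasurePreserving T μ μ) (hE : PreErgodic T μ)
    (hf : Measurable f) (hfi : Integrable f μ) (hneg : ∫ x, f x ∂μ < 0) :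
    ∀ᵐ x ∂μ, ∃ k : ℕ, ∀ n, birkhoffSum T f n x ≤ k := by
  have h0 := setIntegral_birkhoffUnbounded_nonneg hT hf hfi
  rcases hE.ae_mem_or_ae_notMem (measurableSet_birkhoffUnbounded hT.measurable hf)
    preimage_birkhoffUnbounded with h | h
  · rw [Measure.restrict_eq_self_of_ae_mem h] at h0
    exact absurd h0 hneg.not_ge
  · filter_upwards [h] with x hx
    simp only [birkhoffUnbounded, Set.mem_ofPred_eq, not_forall, not_exists, not_le] at hx
    obtain ⟨k, hk⟩ := hx
    exact ⟨k, fun n => (birkhoffSum_le_birkhoffMax n x).trans (hk n).le⟩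

/-- Subtracting a constant slightly above the mean makes the integral negative. The sums are then
bounded above, and dividing the bound by `n` costs less than the remaining `η / 2`. -/
lemma ae_eventually_birkhoffAverage_le [IsProbabilityMeasure μ] (hT : MeasurePreserving T μ μ)
    (hE : PreErgodic T μ) (hf : Measurable f) (hfi : Integrable f μ) {η : ℝ} (hη : 0 < η) :
    ∀ᵐ x ∂μ, ∀ᶠ n in atTop, birkhoffAverage ℝ T f n x ≤ ∫ x, f x ∂μ + η := by
  set c := ∫ x, f x ∂μ + η / 2 with hc
  have hint : ∫ x, (f x - c) ∂μ < 0 := by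
    rw [integral_sub hfi (integrable_const _)]
    simp [hc, hη]
  filter_upwards [ae_birkhoffSum_bddAbove hT hE (hf.sub_const c)
    (hfi.sub (integrable_const c)) hint] with x ⟨k, hk⟩
  obtain ⟨N, hN⟩ := exists_nat_gt (k / (η / 2))
  filter_upwards [eventually_ge_atTop N, eventually_gt_atTop 0] with n hn hn0
  have h1 := hk n
  have hn0' : (0 : ℝ) < n := Nat.cast_pos.2 hn0
  simp only [birkhoffSum, Finset.sum_sub_distrib, Finset.sum_const, Finset.card_range,
    nsmul_eq_mul] at h1
  rw [birkhoffAverage, smul_eq_mul, inv_mul_le_iff₀ hn0', birkhoffSum]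
  rw [div_lt_iff₀ (by positivity)] at hN
  have : (N : ℝ) * (η / 2) ≤ n * (η / 2) := by gcongr
  rw [hc] at h1
  nlinarith

/-- **Birkhoff's pointwise ergodic theorem** for an ergodic map of a probability space. -/
theorem ae_tendsto_birkhoffAverage [IsProbabilityMeasure μ] (hT : MeasurePreserving T μ μ)
    (hE : PreErgodic T μ) (hf : Measurable f) (hfi : Integrable f μ) :
    ∀ᵐ x ∂μ, Tendsto (fun n => birkhoffAverage ℝ T f n x) atTop (𝓝 (∫ x, f x ∂μ)) := by
  have hη (j : ℕ) : (0 : ℝ) < 1 / (j + 1) := by positivity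
  have hup := ae_all_iff.2 fun j => ae_eventually_birkhoffAverage_le hT hE hf hfi (hη j)
  have hlo := ae_all_iff.2 fun j => ae_eventually_birkhoffAverage_le hT hE hf.neg hfi.neg (hη j)
  filter_upwards [hup, hlo] with x hx hx'
  rw [Metric.tendsto_nhds]
  intro ε hε
  obtain ⟨j, hj⟩ := exists_nat_one_div_lt hε
  filter_upwards [hx j, hx' j] with n h1 h2
  have h3 : birkhoffAverage ℝ T (-f) n x = -birkhoffAverage ℝ T f n x := by
    simp [birkhoffAverage, birkhoffSum]
  have h4 : ∫ x, (-f) x ∂μ = -∫ x, f x ∂μ := integral_neg f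
  rw [h3, h4] at h2
  rw [Real.dist_eq, abs_lt]
  constructor <;> linarith

end Birkhoff

/-! ### Stationary ergodic processes -/

section Stationary

/-- The average of `g` over the first `m` terms of the sequence `x`. -/
noncomputable def empiricalMean {α : Type*} (x : ℕ → α) (m : ℕ) (g : α → ℝ) : ℝ :=
  (m : ℝ)⁻¹ * ∑ i ∈ Finset.range m, g (x i)

lemma iterate_seqShift_apply_zero {α : Type*} (x : ℕ → α) (i : ℕ) : (seqShift^[i] x) 0 = x i := by
  induction i generalizing x with
  | zero => rfl
  | succ i ih => rw [Function.iterate_succ_apply, ih]; rfl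

variable {Ω α : Type*} [MeasurableSpace Ω] [MeasurableSpace α] {X : ℕ → Ω → α} {P : Measure Ω}

lemma IsStationaryErgodic.measurable_path (hX : IsStationaryErgodic X P) :
    Measurable fun ω n => X n ω :=
  measurable_pi_lambda _ hX.measurable

/-- The strong law of large numbers for a stationary ergodic process. -/
theorem IsStationaryErgodic.ae_tendsto_empiricalMean [IsProbabilityMeasure P]
    (hX : IsStationaryErgodic X P) {g : α → ℝ} (hg : Measurable g)
    (hgi : Integrable (fun ω => g (X 0 ω)) P) :
    ∀ᵐ ω ∂P, Tendsto (fun m => empiricalMean (fun n => X n ω) m g) atTop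
      (𝓝 (∫ ω, g (X 0 ω) ∂P)) := by
  have hpath := hX.measurable_path
  have hg0 : Measurable fun x : ℕ → α => g (x 0) := hg.comp (measurable_pi_apply 0)
  have : IsProbabilityMeasure (processLaw X P) :=
    Measure.isProbabilityMeasure_map hpath.aemeasurable
  have hint : Integrable (fun x : ℕ → α => g (x 0)) (processLaw X P) :=
    (integrable_map_measure hg0.aestronglyMeasurable hpath.aemeasurable).2 hgi
  have hlaw := ae_tendsto_birkhoffAverage hX.stationary hX.ergodic hg0 hint
  have hval : ∫ x, g (x 0) ∂(processLaw X P) = ∫ ω, g (X 0 ω) ∂P :=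
    integral_map hpath.aemeasurable hg0.aestronglyMeasurable
  rw [hval] at hlaw
  filter_upwards [ae_of_ae_map hpath.aemeasurable hlaw] with ω hω
  simpa only [empiricalMean, birkhoffAverage, birkhoffSum, smul_eq_mul, iterate_seqShift_apply_zero]
    using hω

lemma IsStationaryErgodic.map_eq (hX : IsStationaryErgodic X P) (i : ℕ) :
    P.map (X i) = P.map (X 0) := by
  have hpath := hX.measurable_path
  have h0 : (fun x : ℕ → α => x i) = (fun x => x 0) ∘ seqShift^[i] := by
    ext x; exact (iterate_seqShift_apply_zero x i).symm
  have hi := hX.stationary.iterate i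
  calc P.map (X i) = (processLaw X P).map (fun x => x i) :=
        (Measure.map_map (measurable_pi_apply i) hpath).symm
    _ = ((processLaw X P).map seqShift^[i]).map (fun x => x 0) := by
        rw [h0, Measure.map_map (measurable_pi_apply 0) hi.measurable]
    _ = P.map (X 0) := by
        rw [hi.map_eq]; exact Measure.map_map (measurable_pi_apply 0) hpath

/-- A property that holds almost surely for `X 0` holds almost surely along the whole path. -/
lemma IsStationaryErgodic.ae_all_of_ae_map (hX : IsStationaryErgodic X P) {p : α → Prop}
    (hp : ∀ᵐ x ∂(P.map (X 0)), p x) : ∀ᵐ ω ∂P, ∀ i, p (X i ω) :=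
  ae_all_iff.2 fun i => ae_of_ae_map (hX.measurable i).aemeasurable (by rwa [hX.map_eq i])

end Stationary

/-! ### Finite VC dimension implies finite bracketing numbers -/

section Bracketing

variable {α : Type*}

/-- A class containing, for every `k`, sets `C_T` (`T ⊆ Fin k`) all of whose Boolean combinations
are nonempty has infinite VC dimension. -/
lemma vcDim_eq_top_of_independent {𝒞 : Set (Set α)}
    (h : ∀ k : ℕ, ∃ c : Finset (Fin k) → Set α, (∀ T, c T ∈ 𝒞) ∧
      ∀ s : Set (Finset (Fin k)), ∃ x, ∀ T, x ∈ c T ↔ T ∈ s) : vcDim 𝒞 = ⊤ := by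
  classical
  refine ENat.eq_top_iff_forall_ge.2 fun k => ?_
  obtain ⟨c, hc, hx⟩ := h k
  -- Duality: `x j` is taken in the cell where membership in `c T` means `j ∈ T`, so `c T` cuts out
  -- exactly the points indexed by `T`.
  choose x hx using fun j : Fin k => hx {T | j ∈ T}
  simp only [Set.mem_ofPred_eq] at hx
  have hinj : Function.Injective x := fun i j hij => by
    have h1 := (hx i {i}).2 (Finset.mem_singleton_self i)
    rw [hij, hx j {i}, Finset.mem_singleton] at h1
    exact h1.symm
  set D : Finset α := Finset.univ.image x with hD
  have hcard : D.card = k := by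
    rw [hD, Finset.card_image_of_injective _ hinj, Finset.card_univ, Fintype.card_fin]
  have hsub : {E : Set α | ∃ C ∈ 𝒞, E = C ∩ (D : Set α)} = 𝒫 (D : Set α) := by
    ext E
    constructor
    · rintro ⟨C, -, rfl⟩
      exact Set.inter_subset_right
    · intro hE
      refine ⟨_, hc (Finset.univ.filter fun j => x j ∈ E), ?_⟩
      ext y
      constructor
      · intro hy
        have hyD := hE hy
        simp only [hD, Finset.coe_image, Finset.coe_univ, Set.image_univ] at hyD
        obtain ⟨j, rfl⟩ := hyD
        exact ⟨(hx j _).2 (by simpa using hy), hE hy⟩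
      · rintro ⟨hy, hyD⟩
        simp only [hD, Finset.coe_image, Finset.coe_univ, Set.image_univ] at hyD
        obtain ⟨j, rfl⟩ := hyD
        simpa using (hx j _).1 hy
  have hsh : shatterCoeff D 𝒞 = 2 ^ D.card := by
    rw [shatterCoeff, hsub, Set.ncard_powerset _ D.finite_toSet, Set.ncard_coe_finset]
  calc (k : ℕ∞) = (D.card : ℕ∞) := by rw [hcard]
    _ ≤ vcDim 𝒞 := le_iSup₂_of_le D hsh le_rfl

variable [MeasurableSpace α] {μ : Measure α}

/-- A family of measurable sets that is closed under finite unions is exhausted, up to null sets,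
by an increasing sequence of its members. -/
lemma exists_monotone_exhaustion [IsFiniteMeasure μ] {𝒮 : Set (Set α)}
    (hm : ∀ s ∈ 𝒮, MeasurableSet s) (hempty : ∅ ∈ 𝒮)
    (hunion : ∀ s ∈ 𝒮, ∀ t ∈ 𝒮, s ∪ t ∈ 𝒮) :
    ∃ V : ℕ → Set α, Monotone V ∧ (∀ n, V n ∈ 𝒮) ∧ ∀ s ∈ 𝒮, μ (s \ ⋃ n, V n) = 0 := by
  obtain ⟨v, -, hv, hv𝒮⟩ := exists_seq_tendsto_sSup (S := μ '' 𝒮) ⟨_, ∅, hempty, rfl⟩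
    (OrderTop.bddAbove _)
  choose w hw hwv using hv𝒮
  have hle : ∀ s ∈ 𝒮, μ s ≤ sSup (μ '' 𝒮) := fun s hs => le_sSup ⟨s, hs, rfl⟩
  have hacc n : Set.accumulate w n ∈ 𝒮 := by
    induction n with
    | zero => simpa [Set.accumulate] using hw 0
    | succ n ih => rw [Set.accumulate_succ]; exact hunion _ ih _ (hw _)
  refine ⟨Set.accumulate w, Set.monotone_accumulate, hacc, fun s hs => ?_⟩
  set V := ⋃ n, Set.accumulate w n with hV
  have hVm : MeasurableSet V := .iUnion fun n => hm _ (hacc n)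
  -- The union `V` has the supremal measure, and adjoining `s` cannot exceed it, so `s \ V` has no
  -- mass.
  have hlow : sSup (μ '' 𝒮) ≤ μ V := by
    refine le_of_tendsto' hv fun n => ?_
    rw [← hwv n]
    exact measure_mono ((Set.subset_accumulate (s := w)).trans (Set.subset_iUnion _ n))
  have hup : μ (V ∪ s) ≤ sSup (μ '' 𝒮) := by
    have hmono : Monotone fun n => Set.accumulate w n ∪ s := fun i j hij =>
      Set.union_subset_union_left _ (Set.monotone_accumulate hij)
    rw [hV, Set.iUnion_union]
    exact le_of_tendsto' (tendsto_measure_iUnion_atTop hmono)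
      fun n => hle _ (hunion _ (hacc n) _ hs)
  rw [← Set.union_sdiff_self, measure_union Set.disjoint_sdiff_right ((hm s hs).diff hVm)] at hup
  have h1 : μ V + μ (s \ V) ≤ μ V + 0 := by rw [add_zero]; exact hup.trans hlow
  simpa using (ENNReal.add_le_add_iff_left (measure_ne_top μ V)).1 h1

variable {J : Type*} {C : J → Set α}

/-- Along an ultrafilter, either the sets `C j` are trapped in a bracket of small measure, or
there is a nonnull set all of whose nonnull subsets are split by most of the `C j`. -/
lemma exists_bracket_or_exists_split [IsFiniteMeasure μ] (𝒰 : Ultrafilter J) {ε : ℝ≥0∞}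
    (hε : ε ≠ 0) :
    (∃ l u : Set α, MeasurableSet l ∧ MeasurableSet u ∧ μ (u \ l) < ε ∧
      ∀ᶠ j in 𝒰, μ (l \ C j) = 0 ∧ μ (C j \ u) = 0) ∨
    ∃ G : Set α, MeasurableSet G ∧ μ G ≠ 0 ∧ ∀ B ⊆ G, MeasurableSet B → μ B ≠ 0 →
      ∀ᶠ j in 𝒰, μ (B ∩ C j) ≠ 0 ∧ μ (B \ C j) ≠ 0 := by
  -- These are the regions decided by the ultrafilter: `a` lies almost inside, `b` almost outside,
  -- most of the `C j`.
  set 𝒮 : Set (Set α) := {s | ∃ a b : Set α, MeasurableSet a ∧ MeasurableSet b ∧ s = a ∪ b ∧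
    (∀ᶠ j in 𝒰, μ (a \ C j) = 0) ∧ ∀ᶠ j in 𝒰, μ (b ∩ C j) = 0} with h𝒮
  have hm : ∀ s ∈ 𝒮, MeasurableSet s := by
    rintro s ⟨a, b, ha, hb, rfl, -, -⟩
    exact ha.union hb
  obtain ⟨V, hVmono, hV𝒮, hV⟩ := exists_monotone_exhaustion (μ := μ) hm
    ⟨∅, ∅, .empty, .empty, by simp, by simp, by simp⟩ (by
      rintro _ ⟨a, b, ha, hb, rfl, ha', hb'⟩ _ ⟨c, d, hc, hd, rfl, hc', hd'⟩
      refine ⟨a ∪ c, b ∪ d, ha.union hc, hb.union hd, Set.union_union_union_comm _ _ _ _, ?_, ?_⟩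
      · filter_upwards [ha', hc'] with j h1 h2
        rw [Set.union_sdiff_distrib]
        exact measure_union_null h1 h2
      · filter_upwards [hb', hd'] with j h1 h2
        rw [Set.union_inter_distrib_right]
        exact measure_union_null h1 h2)
  have hVm n : MeasurableSet (V n) := hm _ (hV𝒮 n)
  by_cases hG : μ (⋃ n, V n)ᶜ = 0
  · left
    have hlim : Tendsto (fun n => μ (V n)ᶜ) atTop (𝓝 (μ (⋂ n, (V n)ᶜ))) :=
      tendsto_measure_iInter_atTop (fun n => (hVm n).compl.nullMeasurableSet)
        (fun i j hij => Set.compl_subset_compl.2 (hVmono hij)) ⟨0, measure_ne_top _ _⟩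
    rw [← Set.compl_iUnion, hG] at hlim
    obtain ⟨n, hn⟩ := (hlim.eventually_lt_const (pos_iff_ne_zero.2 hε)).exists
    obtain ⟨a, b, ha, hb, hab, ha', hb'⟩ := hV𝒮 n
    -- The gap of this bracket is exactly the undecided region, the complement of `V n`.
    refine ⟨a, bᶜ, ha, hb.compl, ?_, ?_⟩
    · rwa [hab, Set.compl_union, Set.inter_comm] at hn
    · filter_upwards [ha', hb'] with j h1 h2
      refine ⟨h1, ?_⟩
      rwa [Set.sdiff_compl, Set.inter_comm]
  · right
    refine ⟨_, (MeasurableSet.iUnion hVm).compl, hG, fun B hBG hB hB0 => ?_⟩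
    have hdiff : B \ ⋃ n, V n = B := by
      rw [Set.sdiff_eq, Set.inter_eq_left.2 hBG]
    -- A nonnull set missing the exhaustion is undecided; for an ultrafilter, failure of "null for
    -- most `j`" means "nonnull for most `j`".
    have hB𝒮 : B ∉ 𝒮 := fun h => hB0 (hdiff ▸ hV B h)
    refine Eventually.and ?_ ?_
    · refine Ultrafilter.eventually_not.2 fun h => hB𝒮 ?_
      exact ⟨∅, B, .empty, hB, by simp, by simp, h⟩
    · refine Ultrafilter.eventually_not.2 fun h => hB𝒮 ?_
      exact ⟨B, ∅, hB, .empty, by simp, h, by simp⟩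

/-- If every nonnull measurable subset of `G` is split by most of the `C j`, then one can choose
finitely many of the `C j` all of whose Boolean combinations are nonnull in `G`. -/
lemma exists_independent_of_split {ι : Type*} (hC : ∀ j, MeasurableSet (C j))
    {𝒰 : Filter J} [𝒰.NeBot] {G : Set α} (hG : MeasurableSet G) (hG0 : μ G ≠ 0)
    (hsplit : ∀ B ⊆ G, MeasurableSet B → μ B ≠ 0 →
      ∀ᶠ j in 𝒰, μ (B ∩ C j) ≠ 0 ∧ μ (B \ C j) ≠ 0) (s : Finset ι) :
    ∃ c : ι → J, ∀ t : Set ι, μ (G ∩ {x | ∀ i ∈ s, x ∈ C (c i) ↔ i ∈ t}) ≠ 0 := by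
  classical
  obtain ⟨j₀⟩ : Nonempty J := 𝒰.nonempty_of_neBot
  have hmeas (c : ι → J) (s : Finset ι) (t : Set ι) :
      MeasurableSet (G ∩ {x | ∀ i ∈ s, x ∈ C (c i) ↔ i ∈ t}) := by
    simp only [Set.ofPred_forall]
    refine hG.inter (s.measurableSet_biInter fun i _ => ?_)
    by_cases hi : i ∈ t <;> simp only [hi, iff_true, iff_false]
    · exact hC _
    · exact (hC _).compl
  induction s using Finset.induction_on with
  | empty => exact ⟨fun _ => j₀, fun t => by simpa using hG0⟩
  | insert a s ha ih =>
    obtain ⟨c, hc⟩ := ih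
    -- A cell depends only on the trace of `t` on `s`, so there are finitely many and a single `j`
    -- splits them all.
    have hev : ∀ᶠ j in 𝒰, ∀ t ∈ s.powerset,
        μ ((G ∩ {x | ∀ i ∈ s, x ∈ C (c i) ↔ i ∈ (t : Set ι)}) ∩ C j) ≠ 0 ∧
        μ ((G ∩ {x | ∀ i ∈ s, x ∈ C (c i) ↔ i ∈ (t : Set ι)}) \ C j) ≠ 0 :=
      (Filter.eventually_all_finset _).2 fun t _ =>
        hsplit _ Set.inter_subset_left (hmeas c s t) (hc t)
    obtain ⟨j, hj⟩ := hev.exists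
    refine ⟨Function.update c a j, fun t => ?_⟩
    obtain ⟨h1, h2⟩ := hj (s.filter (· ∈ t)) (by simp)
    by_cases hat : a ∈ t
    · refine fun h0 => h1 (measure_mono_null ?_ h0)
      rintro x ⟨⟨hxG, hx⟩, hxj⟩
      refine ⟨hxG, fun i hi => ?_⟩
      rcases Finset.mem_insert.1 hi with rfl | hi
      · simpa [hat] using hxj
      · have hne : i ≠ a := fun h => ha (h ▸ hi)
        simpa [hne, hi] using hx i hi
    · refine fun h0 => h2 (measure_mono_null ?_ h0)
      rintro x ⟨⟨hxG, hx⟩, hxj⟩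
      refine ⟨hxG, fun i hi => ?_⟩
      rcases Finset.mem_insert.1 hi with rfl | hi
      · simpa [hat] using hxj
      · have hne : i ≠ a := fun h => ha (h ▸ hi)
        simpa [hne, hi] using hx i hi

/-- A family of sets of finite VC dimension has finite bracketing numbers for every finite measure. -/
theorem exists_finite_brackets [IsFiniteMeasure μ] (hC : ∀ j, MeasurableSet (C j))
    (hvc : vcDim (Set.range C) ≠ ⊤) {ε : ℝ≥0∞} (hε : ε ≠ 0) :
    ∃ Q : Set (Set α × Set α), Q.Finite ∧
      (∀ q ∈ Q, MeasurableSet q.1 ∧ MeasurableSet q.2 ∧ μ (q.2 \ q.1) < ε) ∧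
      ∀ j, ∃ q ∈ Q, μ (q.1 \ C j) = 0 ∧ μ (C j \ q.2) = 0 := by
  classical
  by_contra! hcon
  set B : Set (Set α × Set α) :=
    {q | MeasurableSet q.1 ∧ MeasurableSet q.2 ∧ μ (q.2 \ q.1) < ε} with hB
  set E : Set α × Set α → Set J := fun q => {j | μ (q.1 \ C j) = 0 → μ (C j \ q.2) ≠ 0} with hE
  -- `E q` is the set of indices not bracketed by `q`; the assumed failure is the finite
  -- intersection property of these sets.
  obtain ⟨𝒰, h𝒰⟩ := Ultrafilter.exists_ultrafilter_of_finite_inter_nonempty (E '' B) (by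
    intro T hT
    obtain ⟨Q, hQB, rfl⟩ := Finset.subset_set_image_iff.1 hT
    obtain ⟨j, hj⟩ := hcon Q Q.finite_toSet fun q hq => hQB hq
    refine ⟨j, ?_⟩
    rw [Finset.coe_image]
    rintro _ ⟨q, hq, rfl⟩
    exact hj q hq)
  rcases exists_bracket_or_exists_split (μ := μ) (C := C) 𝒰 hε with
    ⟨l, u, hl, hu, hlu, hev⟩ | ⟨G, hG, hG0, hsplit⟩
  · have h1 : ∀ᶠ j in 𝒰, j ∈ E (l, u) := h𝒰 ⟨(l, u), ⟨hl, hu, hlu⟩, rfl⟩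
    obtain ⟨j, hj, hj'⟩ := (hev.and h1).exists
    exact hj' hj.1 hj.2
  · refine hvc (vcDim_eq_top_of_independent fun k => ?_)
    obtain ⟨c, hc⟩ := exists_independent_of_split (μ := μ) hC hG hG0 hsplit
      (Finset.univ : Finset (Finset (Fin k)))
    refine ⟨fun T => C (c T), fun T => ⟨_, rfl⟩, fun s => ?_⟩
    obtain ⟨x, -, hx⟩ := nonempty_of_measure_ne_zero (hc s)
    exact ⟨x, fun T => hx T (Finset.mem_univ T)⟩

end Bracketing

/-! ### Elementary rules for empirical means -/

section EmpiricalMean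

variable {α : Type*} {x : ℕ → α} {g h : α → ℝ}

lemma empiricalMean_mono {m : ℕ} (hgh : ∀ i, g (x i) ≤ h (x i)) :
    empiricalMean x m g ≤ empiricalMean x m h :=
  mul_le_mul_of_nonneg_left (Finset.sum_le_sum fun i _ => hgh i) (by positivity)

lemma empiricalMean_add (m : ℕ) :
    empiricalMean x m (fun y => g y + h y) = empiricalMean x m g + empiricalMean x m h := by
  simp [empiricalMean, Finset.sum_add_distrib, mul_add]

lemma empiricalMean_const_mul (m : ℕ) (c : ℝ) :
    empiricalMean x m (fun y => c * g y) = c * empiricalMean x m g := by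
  simp only [empiricalMean, ← Finset.mul_sum]
  ring

lemma empiricalMean_const {m : ℕ} (hm : m ≠ 0) (c : ℝ) :
    empiricalMean x m (fun _ => c) = c := by
  simp [empiricalMean, hm]

lemma empiricalMean_finset_sum {ι : Type*} (s : Finset ι) (φ : ι → α → ℝ) (m : ℕ) :
    empiricalMean x m (fun y => ∑ k ∈ s, φ k y) = ∑ k ∈ s, empiricalMean x m (φ k) := by
  simp only [empiricalMean, ← Finset.mul_sum]
  rw [Finset.sum_comm]

lemma abs_empiricalMean_le (m : ℕ) :
    |empiricalMean x m g| ≤ empiricalMean x m fun y => |g y| := by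
  rw [empiricalMean, abs_mul, abs_of_nonneg (by positivity : (0 : ℝ) ≤ (m : ℝ)⁻¹)]
  exact mul_le_mul_of_nonneg_left (Finset.abs_sum_le_sum_abs _ _) (by positivity)

end EmpiricalMean

/-! ### The uniform law for sets -/

section Sets

variable {Ω α J : Type*} [MeasurableSpace Ω] [MeasurableSpace α] {X : ℕ → Ω → α} {P : Measure Ω}
  {C : J → Set α}

lemma integral_indicator_one_comp {Y : Ω → α} (hY : Measurable Y) {s : Set α}
    (hs : MeasurableSet s) :
    ∫ ω, s.indicator (1 : α → ℝ) (Y ω) ∂P = (P.map Y).real s := by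
  rw [← integral_indicator_one hs, integral_map hY.aemeasurable]
  exact (measurable_one.indicator hs).aestronglyMeasurable

variable [IsProbabilityMeasure P]

lemma integrable_indicator_one_comp {Y : Ω → α} (hY : Measurable Y) {s : Set α}
    (hs : MeasurableSet s) : Integrable (fun ω => s.indicator (1 : α → ℝ) (Y ω)) P :=
  Integrable.of_bound ((measurable_one.indicator hs).comp hY).aestronglyMeasurable 1
    (ae_of_all _ fun ω => by by_cases h : Y ω ∈ s <;> simp [h])

/-- Each set is sandwiched in one of finitely many brackets: `η / 2` pays for the gap of the
bracket, `η / 2` for the law of large numbers at its ends. -/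
lemma IsStationaryErgodic.ae_forall_abs_empiricalMean_sub_le [Countable J]
    (hX : IsStationaryErgodic X P) (hC : ∀ j, MeasurableSet (C j))
    (hvc : vcDim (Set.range C) ≠ ⊤) {η : ℝ} (hη : 0 < η) :
    ∀ᵐ ω ∂P, ∀ᶠ m in atTop, ∀ j,
      |empiricalMean (fun n => X n ω) m ((C j).indicator 1) -
        ∫ ω, (C j).indicator (1 : α → ℝ) (X 0 ω) ∂P| ≤ η := by
  set μ := P.map (X 0) with hμ
  have hX0 := hX.measurable 0
  have : IsProbabilityMeasure μ := Measure.isProbabilityMeasure_map hX0.aemeasurable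
  obtain ⟨Q, hQ, hQb, hQC⟩ := exists_finite_brackets (μ := μ) hC hvc
    (ε := ENNReal.ofReal (η / 2)) (by simpa using hη)
  have hnull {s t : Set α} (hst : μ (s \ t) = 0) : ∀ᵐ ω ∂P, ∀ i, X i ω ∈ s → X i ω ∈ t := by
    refine hX.ae_all_of_ae_map (p := fun x => x ∈ s → x ∈ t) ?_
    exact ae_le_set.2 hst
  have hlaw : ∀ᵐ ω ∂P, ∀ q ∈ Q,
      Tendsto (fun m => empiricalMean (fun n => X n ω) m (q.1.indicator 1)) atTop
        (𝓝 (μ.real q.1)) ∧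
      Tendsto (fun m => empiricalMean (fun n => X n ω) m (q.2.indicator 1)) atTop
        (𝓝 (μ.real q.2)) := by
    refine (ae_ball_iff hQ.countable).2 fun q hq => ?_
    obtain ⟨h1, h2, -⟩ := hQb q hq
    have e1 := hX.ae_tendsto_empiricalMean (measurable_one.indicator h1)
      (integrable_indicator_one_comp hX0 h1)
    have e2 := hX.ae_tendsto_empiricalMean (measurable_one.indicator h2)
      (integrable_indicator_one_comp hX0 h2)
    rw [integral_indicator_one_comp hX0 h1] at e1
    rw [integral_indicator_one_comp hX0 h2] at e2
    exact e1.and e2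
  -- Brackets hold only up to null sets. By stationarity the path almost surely never meets the
  -- exceptional set of a given `j`, and there are countably many `j`.
  have hpath : ∀ᵐ ω ∂P, ∀ j, ∃ q ∈ Q, μ (q.1 \ C j) = 0 ∧ μ (C j \ q.2) = 0 ∧
      (∀ i, X i ω ∈ q.1 → X i ω ∈ C j) ∧ ∀ i, X i ω ∈ C j → X i ω ∈ q.2 := by
    refine ae_all_iff.2 fun j => ?_
    obtain ⟨q, hq, h1, h2⟩ := hQC j
    filter_upwards [hnull h1, hnull h2] with ω hω1 hω2
    exact ⟨q, hq, h1, h2, hω1, hω2⟩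
  filter_upwards [hlaw, hpath] with ω hω hωp
  have hev : ∀ᶠ m in atTop, ∀ q ∈ Q,
      μ.real q.1 - η / 2 < empiricalMean (fun n => X n ω) m (q.1.indicator 1) ∧
      empiricalMean (fun n => X n ω) m (q.2.indicator 1) < μ.real q.2 + η / 2 :=
    (eventually_all_finite hQ).2 fun q hq =>
      ((hω q hq).1.eventually_const_lt (by linarith)).and
        ((hω q hq).2.eventually_lt_const (by linarith))
  filter_upwards [hev] with m hm j
  obtain ⟨q, hq, h1, h2, hp1, hp2⟩ := hωp j
  obtain ⟨hq1, hq2, hqlt⟩ := hQb q hq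
  have hmono {s t : Set α} (hst : ∀ i, X i ω ∈ s → X i ω ∈ t) :
      empiricalMean (fun n => X n ω) m (s.indicator 1) ≤
        empiricalMean (fun n => X n ω) m (t.indicator 1) := by
    refine empiricalMean_mono fun i => ?_
    by_cases hs : X i ω ∈ s
    · simp [hs, hst i hs]
    · rw [Set.indicator_of_notMem hs]
      exact Set.indicator_nonneg (fun _ _ => zero_le_one) _
  have hreal {s t : Set α} (hst : μ (s \ t) = 0) : μ.real s ≤ μ.real t :=
    ENNReal.toReal_mono (measure_ne_top _ _) (measure_mono_ae (ae_le_set.2 hst))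
  have hgap : μ.real q.2 ≤ μ.real q.1 + η / 2 := by
    have e1 : μ.real q.2 ≤ μ.real q.1 + μ.real (q.2 \ q.1) :=
      (measureReal_mono (by rw [Set.union_sdiff_self]; exact Set.subset_union_right)).trans
        (measureReal_union_le _ _)
    have e2 : μ.real (q.2 \ q.1) ≤ η / 2 :=
      ENNReal.toReal_le_of_le_ofReal (by positivity) hqlt.le
    linarith
  rw [integral_indicator_one_comp hX0 (hC j), ← hμ, abs_le]
  have := hmono hp1
  have := hmono hp2
  have := hreal h1
  have := hreal h2
  have := hm q hq
  constructor <;> linarith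

/-- A countable family of measurable sets of finite VC dimension is a Glivenko–Cantelli class for
every stationary ergodic process. -/
theorem IsStationaryErgodic.ae_glivenkoCantelli_indicator [Countable J]
    (hX : IsStationaryErgodic X P) (hC : ∀ j, MeasurableSet (C j))
    (hvc : vcDim (Set.range C) ≠ ⊤) :
    ∀ᵐ ω ∂P, ∀ η > 0, ∀ᶠ m in atTop, ∀ j,
      |empiricalMean (fun n => X n ω) m ((C j).indicator 1) -
        ∫ ω, (C j).indicator (1 : α → ℝ) (X 0 ω) ∂P| ≤ η := by
  have h := ae_all_iff.2 fun k : ℕ => hX.ae_forall_abs_empiricalMean_sub_le hC hvc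
    (η := 1 / (k + 1)) (by positivity)
  filter_upwards [h] with ω hω η hη
  obtain ⟨k, hk⟩ := exists_nat_one_div_lt hη
  filter_upwards [hω k] with m hm j using (hm j).trans hk.le

end Sets

/-! ### Approximation by indicators of level sets -/

section StepApproximation

variable {α : Type*}

/-- The approximation of `f`, truncated at height `M`, by a combination of indicators of its level
sets at the levels `-M + k / N`, `k < 2 M N`. -/
noncomputable def levelStep (M N : ℕ) (f : α → ℝ) (x : α) : ℝ :=
  M + -(N : ℝ)⁻¹ * ∑ k ∈ Finset.range (2 * M * N), (levelSet f (-M + k / N)).indicator 1 x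

/-- The levels counted are those with `⌈(f x + M) * N⌉₊ ≤ k`. The natural-number ceiling and
truncated subtraction handle `f x` below `-M` and above `M`. -/
lemma sum_indicator_levelSet {M N : ℕ} (hN : N ≠ 0) (f : α → ℝ) (x : α) :
    ∑ k ∈ Finset.range (2 * M * N), (levelSet f (-M + k / N)).indicator (1 : α → ℝ) x =
      (2 * M * N - ⌈(f x + M) * N⌉₊ : ℕ) := by
  classical
  have hN0 : (0 : ℝ) < N := by positivity
  have hfilter : (Finset.range (2 * M * N)).filter (fun k : ℕ => x ∈ levelSet f (-M + k / N)) =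
      Finset.Ico ⌈(f x + M) * N⌉₊ (2 * M * N) := by
    ext k
    have hk : f x ≤ -M + k / N ↔ (f x + M) * N ≤ k := by
      rw [← le_div_iff₀ hN0]
      constructor <;> intro h <;> linarith
    rw [Finset.mem_filter, Finset.mem_range, Finset.mem_Ico, Nat.ceil_le, and_comm, ← hk]
    rfl
  simp only [Set.indicator_apply, Pi.one_apply]
  rw [Finset.sum_boole, hfilter, Nat.card_Ico]

lemma abs_levelStep_le {M N : ℕ} (hN : N ≠ 0) (f : α → ℝ) (x : α) :
    |levelStep M N f x| ≤ M := by
  have hN0 : (0 : ℝ) < N := by positivity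
  rw [levelStep, sum_indicator_levelSet hN]
  set c := 2 * M * N - ⌈(f x + M) * N⌉₊ with hc
  have hcle : (c : ℝ) ≤ 2 * M * N := by exact_mod_cast Nat.sub_le _ _
  have h1 : (N : ℝ)⁻¹ * c ≤ 2 * M := by
    rw [inv_mul_le_iff₀ hN0]; linarith
  have h2 : 0 ≤ (N : ℝ)⁻¹ * c := by positivity
  rw [abs_le]
  constructor <;> linarith

lemma abs_sub_levelStep_le {M N : ℕ} (hN : N ≠ 0) {f : α → ℝ} {x : α} (hx : |f x| ≤ M) :
    |f x - levelStep M N f x| ≤ (N : ℝ)⁻¹ := by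
  have hN0 : (0 : ℝ) < N := by positivity
  obtain ⟨hx1, hx2⟩ := abs_le.1 hx
  have hz : 0 ≤ (f x + M) * N := mul_nonneg (by linarith) hN0.le
  have hle : ⌈(f x + M) * N⌉₊ ≤ 2 * M * N := by
    rw [Nat.ceil_le]
    push_cast
    exact mul_le_mul_of_nonneg_right (by linarith) hN0.le
  rw [levelStep, sum_indicator_levelSet hN, Nat.cast_sub hle]
  push_cast
  have h1 := Nat.le_ceil ((f x + M) * N)
  have h2 := Nat.ceil_lt_add_one hz
  set c : ℝ := (⌈(f x + M) * N⌉₊ : ℝ)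
  have heq : f x - (M + -(N : ℝ)⁻¹ * (2 * M * N - c)) = (N : ℝ)⁻¹ * ((f x + M) * N - c) := by
    field_simp
    ring
  rw [heq, abs_mul, abs_of_pos (inv_pos.2 hN0)]
  refine mul_le_of_le_one_right (inv_nonneg.2 hN0.le) ?_
  rw [abs_le]
  constructor <;> linarith

/-- Where `F x ≤ M` no truncation occurs; elsewhere both `|f x|` and the step function are at most
`F x`. -/
lemma abs_sub_levelStep_le_add {M N : ℕ} (hN : N ≠ 0) {f F : α → ℝ} {x : α} (hF : |f x| ≤ F x) :
    |f x - levelStep M N f x| ≤ (N : ℝ)⁻¹ + 2 * {y | (M : ℝ) < F y}.indicator F x := by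
  by_cases hx : (M : ℝ) < F x
  · rw [Set.indicator_of_mem (by exact hx)]
    have h1 := abs_sub (f x) (levelStep M N f x)
    have h2 := abs_levelStep_le (M := M) hN f x
    have h3 : (0 : ℝ) ≤ (N : ℝ)⁻¹ := by positivity
    linarith
  · rw [Set.indicator_of_notMem (by exact hx)]
    simpa using abs_sub_levelStep_le hN (hF.trans (not_lt.1 hx))

end StepApproximation

/-! ### The uniform law for VC-major classes -/

section Main

variable {Ω α : Type*} [MeasurableSpace Ω] [MeasurableSpace α] {X : ℕ → Ω → α} {P : Measure Ω}
  [IsProbabilityMeasure P]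

lemma measurableSet_levelSet {f : α → ℝ} (hf : Measurable f) (a : ℝ) :
    MeasurableSet (levelSet f a) :=
  measurableSet_le hf measurable_const

lemma integrable_levelStep_comp {Y : Ω → α} (hY : Measurable Y) {f : α → ℝ} (hf : Measurable f)
    (M N : ℕ) : Integrable (fun ω => levelStep M N f (Y ω)) P :=
  (integrable_const _).add ((integrable_finsetSum _ fun _ _ =>
    integrable_indicator_one_comp hY (measurableSet_levelSet hf _)).const_mul _)

/-- The deviation of `levelStep M N f` is controlled by the deviations of the level sets of `f`. -/
lemma abs_empiricalMean_levelStep_sub_le {x : ℕ → α} {Y : Ω → α} (hY : Measurable Y) {f : α → ℝ}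
    (hf : Measurable f) {M N m : ℕ} (hN : N ≠ 0) (hm : m ≠ 0) {η : ℝ}
    (h : ∀ k < 2 * M * N, |empiricalMean x m ((levelSet f (-M + k / N)).indicator 1) -
      ∫ ω, (levelSet f (-M + k / N)).indicator (1 : α → ℝ) (Y ω) ∂P| ≤ η) :
    |empiricalMean x m (levelStep M N f) - ∫ ω, levelStep M N f (Y ω) ∂P| ≤ 2 * M * η := by
  have hN0 : (0 : ℝ) < N := by positivity
  have hint (k : ℕ) : Integrable
      (fun ω => (levelSet f (-M + k / N)).indicator (1 : α → ℝ) (Y ω)) P :=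
    integrable_indicator_one_comp hY (measurableSet_levelSet hf _)
  have h1 : empiricalMean x m (levelStep M N f) = M + -(N : ℝ)⁻¹ *
      ∑ k ∈ Finset.range (2 * M * N),
        empiricalMean x m ((levelSet f (-M + k / N)).indicator 1) := by
    rw [← empiricalMean_finset_sum, ← empiricalMean_const_mul,
      ← empiricalMean_const (x := x) hm (M : ℝ), ← empiricalMean_add, empiricalMean_const hm]
    rfl
  have h2 : ∫ ω, levelStep M N f (Y ω) ∂P = M + -(N : ℝ)⁻¹ *
      ∑ k ∈ Finset.range (2 * M * N),
        ∫ ω, (levelSet f (-M + k / N)).indicator (1 : α → ℝ) (Y ω) ∂P := by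
    simp only [levelStep]
    rw [integral_add (integrable_const _)
      ((integrable_finsetSum _ fun k _ => hint k).const_mul _), integral_const_mul,
      integral_finsetSum _ fun k _ => hint k]
    simp
  rw [h1, h2, add_sub_add_left_eq_sub, ← mul_sub, ← Finset.sum_sub_distrib, abs_mul, abs_neg,
    abs_of_pos (inv_pos.2 hN0), inv_mul_le_iff₀ hN0]
  refine (Finset.abs_sum_le_sum_abs _ _).trans ?_
  refine (Finset.sum_le_sum fun k hk => h k (Finset.mem_range.1 hk)).trans_eq ?_
  simp
  ring

/-- A countable class of measurable functions with integrable envelope whose families of level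
sets all have finite VC dimension satisfies the uniform law of large numbers. -/
theorem IsStationaryErgodic.ae_eventually_forall_abs_sub_le (hX : IsStationaryErgodic X P)
    {𝓕 : Set (α → ℝ)} (hcount : 𝓕.Countable) (hmeas : ∀ f ∈ 𝓕, Measurable f) {F : α → ℝ}
    (hF : IsEnvelope F 𝓕) (hFX : Integrable (fun ω => F (X 0 ω)) P)
    (hint : ∀ f ∈ 𝓕, Integrable (fun ω => f (X 0 ω)) P)
    (hvc : ∀ a : ℝ, vcDim {L : Set α | ∃ f ∈ 𝓕, L = levelSet f a} ≠ ⊤) :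
    ∀ᵐ ω ∂P, ∀ η > 0, ∀ᶠ m in atTop, ∀ f ∈ 𝓕,
      |empiricalMean (fun n => X n ω) m f - ∫ ω, f (X 0 ω) ∂P| ≤ η := by
  have hX0 := hX.measurable 0
  have : Countable 𝓕 := hcount.to_subtype
  set R : ℕ → α → ℝ := fun M => {y | (M : ℝ) < F y}.indicator F with hR
  have hSm (M : ℕ) : MeasurableSet {y | (M : ℝ) < F y} :=
    measurableSet_lt measurable_const hF.measurable
  have hRm (M : ℕ) : Measurable (R M) := hF.measurable.indicator (hSm M)
  have hRi (M : ℕ) : Integrable (fun ω => R M (X 0 ω)) P :=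
    hFX.indicator (hX0 (hSm M))
  have hRlim : Tendsto (fun M => ∫ ω, R M (X 0 ω) ∂P) atTop (𝓝 0) := by
    rw [← integral_zero Ω ℝ (μ := P)]
    refine tendsto_integral_of_dominated_convergence (fun ω => F (X 0 ω))
      (fun M => (hRi M).aestronglyMeasurable) hFX (fun M => ae_of_all _ fun ω => ?_)
      (ae_of_all _ fun ω => ?_)
    · refine (norm_indicator_le_norm_self _ _).trans ?_
      rw [Real.norm_eq_abs, abs_of_nonneg (hF.nonneg _)]
    · obtain ⟨K, hK⟩ := exists_nat_ge (F (X 0 ω))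
      refine tendsto_const_nhds.congr' ?_
      filter_upwards [eventually_ge_atTop K] with M hM
      refine (Set.indicator_of_notMem (fun h => ?_) _).symm
      exact (not_lt.2 (hK.trans (Nat.cast_le.2 hM))) h
  -- `M` and `N` will depend on `η`, so one null set must serve all of the countably many levels.
  have hsets : ∀ᵐ ω ∂P, ∀ M N k : ℕ, ∀ η > 0, ∀ᶠ m in atTop, ∀ f : 𝓕,
      |empiricalMean (fun n => X n ω) m ((levelSet f.1 (-M + k / N)).indicator 1) -
        ∫ ω, (levelSet f.1 (-M + k / N)).indicator (1 : α → ℝ) (X 0 ω) ∂P| ≤ η := by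
    refine ae_all_iff.2 fun M => ae_all_iff.2 fun N => ae_all_iff.2 fun k => ?_
    refine hX.ae_glivenkoCantelli_indicator (C := fun f : 𝓕 => levelSet f.1 (-M + k / N))
      (fun f => measurableSet_levelSet (hmeas f.1 f.2) _) ?_
    convert hvc (-M + k / N) using 2
    ext L
    simp [eq_comm]
  have htail := ae_all_iff.2 fun M => hX.ae_tendsto_empiricalMean (hRm M) (hRi M)
  filter_upwards [hsets, htail] with ω hω hωR η hη
  -- Error budget in tenths of `η`: three for the empirical approximation, three for the expected
  -- one, one for the level sets.
  obtain ⟨M, hM⟩ := (hRlim.eventually_lt_const (show (0 : ℝ) < η / 10 by positivity)).exists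
  obtain ⟨N', hN'⟩ := exists_nat_one_div_lt (show (0 : ℝ) < η / 10 by positivity)
  set N := N' + 1 with hNdef
  have hN : N ≠ 0 := Nat.succ_ne_zero _
  have hNη : (N : ℝ)⁻¹ < η / 10 := by simpa [hNdef] using hN'
  -- The level-set deviations get multiplied by `2 * M`; the added `1` covers `M = 0`.
  have hδ : 0 < η / 10 / (2 * M + 1) := by positivity
  have hall : ∀ᶠ m in atTop, ∀ k ∈ Finset.range (2 * M * N), ∀ f : 𝓕,
      |empiricalMean (fun n => X n ω) m ((levelSet f.1 (-M + k / N)).indicator 1) -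
        ∫ ω, (levelSet f.1 (-M + k / N)).indicator (1 : α → ℝ) (X 0 ω) ∂P| ≤
          η / 10 / (2 * M + 1) :=
    (eventually_all_finset _).2 fun k _ => hω M N k _ hδ
  filter_upwards [hall, (hωR M).eventually_lt_const hM,
    eventually_ne_atTop 0] with m hm hmR hm0 f hf
  have hfm := hmeas f hf
  have hstep := abs_empiricalMean_levelStep_sub_le (P := P) (x := fun n => X n ω) hX0 hfm hN hm0
    fun k hk => hm k (Finset.mem_range.2 hk) ⟨f, hf⟩
  have hstep' : 2 * M * (η / 10 / (2 * M + 1)) ≤ η / 10 := by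
    rw [mul_div_assoc', div_le_iff₀ (by positivity)]
    nlinarith
  have hpt (y : α) : |f y - levelStep M N f y| ≤ (N : ℝ)⁻¹ + 2 * R M y :=
    abs_sub_levelStep_le_add hN (hF.abs_le f hf y)
  have hemp : |empiricalMean (fun n => X n ω) m f -
      empiricalMean (fun n => X n ω) m (levelStep M N f)| ≤
        (N : ℝ)⁻¹ + 2 * empiricalMean (fun n => X n ω) m (R M) := by
    have e1 : empiricalMean (fun n => X n ω) m f =
        empiricalMean (fun n => X n ω) m (fun y => f y - levelStep M N f y) +
          empiricalMean (fun n => X n ω) m (levelStep M N f) := by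
      rw [← empiricalMean_add]
      simp
    rw [e1, add_sub_cancel_right]
    refine (abs_empiricalMean_le m).trans
      ((empiricalMean_mono (h := fun y => (N : ℝ)⁻¹ + 2 * R M y)
        fun i => hpt (X i ω)).trans_eq ?_)
    rw [empiricalMean_add, empiricalMean_const hm0, empiricalMean_const_mul]
  have hexp : |∫ ω, f (X 0 ω) ∂P - ∫ ω, levelStep M N f (X 0 ω) ∂P| ≤
      (N : ℝ)⁻¹ + 2 * ∫ ω, R M (X 0 ω) ∂P := by
    rw [← integral_sub (hint f hf) (integrable_levelStep_comp hX0 hfm M N)]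
    refine (abs_integral_le_integral_abs).trans ?_
    refine (integral_mono ((hint f hf).sub (integrable_levelStep_comp hX0 hfm M N)).abs
      ((integrable_const _).add ((hRi M).const_mul 2)) fun ω => hpt (X 0 ω)).trans_eq ?_
    simp only [Pi.add_apply]
    rw [integral_add (integrable_const _) ((hRi M).const_mul 2), integral_const_mul]
    simp
  rw [abs_le] at hstep hemp hexp ⊢
  constructor <;> linarith

end Main

theorem proposition1 {𝒳 : Type*} [MetricSpace 𝒳] [CompleteSpace 𝒳]
    [TopologicalSpace.SeparableSpace 𝒳] [MeasurableSpace 𝒳] [BorelSpace 𝒳]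
    (𝓕 : Set (𝒳 → ℝ)) (h𝓕_countable : 𝓕.Countable) (h𝓕_meas : ∀ f ∈ 𝓕, Measurable f)
    (F : 𝒳 → ℝ) (hF : IsEnvelope F 𝓕) (h𝓕_major : IsVCMajor 𝓕)
    {Ω : Type*} [MeasurableSpace Ω] (P : Measure Ω) [IsProbabilityMeasure P]
    (X : ℕ → Ω → 𝒳) (hX : IsStationaryErgodic X P)
    (hFX : Integrable (fun ω => F (X 0 ω)) P) :
    IsGlivenkoCantelli 𝓕 X P := by
  have hint : ∀ f ∈ 𝓕, Integrable (fun ω => f (X 0 ω)) P := fun f hf =>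
    hFX.mono' ((h𝓕_meas f hf).comp (hX.measurable 0)).aestronglyMeasurable
      (ae_of_all _ fun ω => hF.abs_le f hf _)
  have hvc (a : ℝ) : vcDim {L : Set 𝒳 | ∃ f ∈ 𝓕, L = levelSet f a} ≠ ⊤ :=
    ((le_iSup (fun a => vcDim {L : Set 𝒳 | ∃ f ∈ 𝓕, L = levelSet f a}) a).trans_lt
      h𝓕_major).ne
  refine ⟨hint, ?_⟩
  filter_upwards [hX.ae_eventually_forall_abs_sub_le h𝓕_countable h𝓕_meas hF hFX hint hvc]
    with ω hω
  refine ENNReal.tendsto_nhds_zero.2 fun ε hε => ?_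
  obtain ⟨η, hη, hηε⟩ : ∃ η : ℝ, 0 < η ∧ ENNReal.ofReal η ≤ ε := by
    obtain ⟨r, hr, hrε⟩ := ENNReal.lt_iff_exists_nnreal_btwn.1 hε
    exact ⟨r, by simpa using hr, by simpa using hrε.le⟩
  filter_upwards [hω η hη] with m hm
  exact iSup₂_le fun f hf => (ENNReal.ofReal_le_ofReal (hm f hf)).trans hηε
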